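/- Theorem (White Gaussian noise added after measurement). Let $n\ge 1$, $\mu\in\mathbb R^n$, let $\Sigma\in\mathbb R^{n\times n}$ be symmetric positive semidefinite with eigenvalues $\lambda_1,\dots,\lambda_n$ (with multiplicities), let $\varepsilon>0$, $\sigma>0$, $0<p<1$, and let $\chi^2_n$ denote the quantile function of the chi-squared distribution with $n$ degrees of freedom. Let $x\sim\mathcal N(\mu,\Sigma)$, and let $w_0,w_1,\dots\sim\mathcal N(0,\sigma^2)$ be independent of each other and jointly independent of $x$. Consider the following algorithm, where $\|\cdot\|$ is the spectral norm for matrices and the Euclidean norm for vectors. Start with $\mu_0=\mu$, $\Sigma_0=\Sigma$, and for $t=0,1,2,\dots$: let $u_t$ be any unit eigenvector of $\Sigma_t$ for its largest eigenvalue $\|\Sigma_t\|$ (chosen independently of the measurement outcomes); allocate the power $$\beta_t=\max\Bigl\{0,\Bigl(\frac{\chi^2_n(p)}{\varepsilon^2}-\frac1{\|\Sigma_t\|}\Bigr)\sigma^2\Bigr\}\quad(\beta_t=0\text{ if }\|\Sigma_t\|=0);$$ set $a_t=\sqrt{\beta_t}\,u_t$; measure $y_t=a_t^\top x+w_t$;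 and update $$\mu_{t+1}=\mu_t+\Sigma_ta_t(a_t^\top\Sigma_ta_t+\sigma^2)^{-1}(y_t-a_t^\top\mu_t),\qquad \Sigma_{t+1}=\Sigma_t-\Sigma_ta_t(a_t^\top\Sigma_ta_t+\sigma^2)^{-1}a_t^\top\Sigma_t .$$ Stop as soon as an iteration ends with $\|\Sigma_{t+1}\|\le\varepsilon^2/\chi^2_n(p)$, and return $\widehat x=\mu_{t+1}$. For every such sequence of choices of eigenvectors, the algorithm stops after some finite number $m\ge1$ of iterations, its total power satisfies $$\sum_{t<m}\|a_t\|^2\le\sum_{i:\lambda_i\neq0}\max\Bigl\{0,\Bigl(\frac{\chi^2_n(p)}{\varepsilon^2}-\frac1{\lambda_i}\Bigr)\sigma^2\Bigr\},$$ and $\|x-\widehat x\|<\varepsilon$ with probability at least $p$. -/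

import Mathlib

open MeasureTheory ProbabilityTheory

namespace InfoGreedy

noncomputable section

/-- The chi-squared distribution with `n` degrees of freedom: the law of the sum of the squares of
`n` independent standard Gaussian random variables. -/
def chiSquared (n : ℕ) : Measure ℝ :=
  (Measure.pi (fun _ : Fin n => gaussianReal 0 1)).map (fun z => ∑ i, z i ^ 2)

/-- The quantile function of the chi-squared distribution with `n` degrees of freedom. -/
def chiSquaredQuantile (n : ℕ) (p : ℝ) : ℝ :=
  sInf {t : ℝ | p ≤ cdf (chiSquared n) t}

/-- The spectral norm (Euclidean operator norm) of a square matrix. For a positive semidefinite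
matrix of positive size this is the largest eigenvalue. -/
def specNorm {n : ℕ} (S : Matrix (Fin n) (Fin n) ℝ) : ℝ :=
  ‖Matrix.toEuclideanCLM (𝕜 := ℝ) S‖

/-- The accuracy threshold `ε² / χ²ₙ(p)` for the eigenvalues of the posterior covariance. -/
def threshold (n : ℕ) (ε p : ℝ) : ℝ :=
  ε ^ 2 / chiSquaredQuantile n p

/-- The power `β = (χ²ₙ(p) / ε² - 1 / lam) σ²` allocated to a direction of variance `lam`. A power
is nonnegative, so `0` is used where the formula is negative; `1 / 0` is read as `+∞`, so that no
power is used for `lam = 0`. -/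
def allocatedPower (n : ℕ) (ε p σ lam : ℝ) : ℝ :=
  if lam = 0 then 0 else max 0 ((chiSquaredQuantile n p / ε ^ 2 - 1 / lam) * σ ^ 2)

variable {n : ℕ}

/-- The measurement vector `a = √β u`, where `S` is the current covariance and `u` is the chosen
unit eigenvector of `S` for the largest eigenvalue `‖S‖`. -/
def measurementVector (ε p σ : ℝ) (S : Matrix (Fin n) (Fin n) ℝ)
    (u : EuclideanSpace ℝ (Fin n)) : EuclideanSpace ℝ (Fin n) :=
  Real.sqrt (allocatedPower n ε p σ (specNorm S)) • u

/-- The factor `(aᵀ S a + σ²)⁻¹`. -/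
def invVariance (σ : ℝ) (S : Matrix (Fin n) (Fin n) ℝ) (a : EuclideanSpace ℝ (Fin n)) : ℝ :=
  (inner ℝ a (Matrix.toEuclideanCLM (𝕜 := ℝ) S a) + σ ^ 2)⁻¹

/-- The covariance update `S ← S - S a (aᵀ S a + σ²)⁻¹ aᵀ S`. -/
def covUpdate (σ : ℝ) (S : Matrix (Fin n) (Fin n) ℝ) (a : EuclideanSpace ℝ (Fin n)) :
    Matrix (Fin n) (Fin n) ℝ :=
  S - invVariance σ S a • Matrix.vecMulVec (Matrix.mulVec S a.ofLp) (Matrix.vecMul a.ofLp S)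

/-- The mean update `μ ← μ + S a (aᵀ S a + σ²)⁻¹ (y - aᵀ μ)` after the outcome `y`. -/
def meanUpdate (σ : ℝ) (S : Matrix (Fin n) (Fin n) ℝ) (a μ : EuclideanSpace ℝ (Fin n)) (y : ℝ) :
    EuclideanSpace ℝ (Fin n) :=
  μ + (invVariance σ S a * (y - inner ℝ a μ)) • Matrix.toEuclideanCLM (𝕜 := ℝ) S a

/-- The covariance matrix held by the algorithm after `t` iterations, when the eigenvectors chosen
in the successive iterations are `u 0, u 1, …`. It does not depend on the outcomes. -/
def cov (ε p σ : ℝ) (S : Matrix (Fin n) (Fin n) ℝ) (u : ℕ → EuclideanSpace ℝ (Fin n)) :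
    ℕ → Matrix (Fin n) (Fin n) ℝ
  | 0 => S
  | t + 1 => covUpdate σ (cov ε p σ S u t) (measurementVector ε p σ (cov ε p σ S u t) (u t))

/-- The measurement vector used in iteration `t` (counted from `0`). -/
def sensing (ε p σ : ℝ) (S : Matrix (Fin n) (Fin n) ℝ) (u : ℕ → EuclideanSpace ℝ (Fin n))
    (t : ℕ) : EuclideanSpace ℝ (Fin n) :=
  measurementVector ε p σ (cov ε p σ S u t) (u t)

/-- The mean held by the algorithm after `t` iterations, when it is run on the signal `x` with
measurement noise `w 0, w 1, …`: the outcome of iteration `t` is `y = aᵀ x + w t`. -/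
def mean (ε p σ : ℝ) (μ : EuclideanSpace ℝ (Fin n)) (S : Matrix (Fin n) (Fin n) ℝ)
    (u : ℕ → EuclideanSpace ℝ (Fin n)) (x : EuclideanSpace ℝ (Fin n)) (w : ℕ → ℝ) :
    ℕ → EuclideanSpace ℝ (Fin n)
  | 0 => μ
  | t + 1 => meanUpdate σ (cov ε p σ S u t) (sensing ε p σ S u t) (mean ε p σ μ S u x w t)
      (inner ℝ (sensing ε p σ S u t) x + w t)

/-- The stopping test, made at the end of each iteration of the repeat-until loop, has failed
after each of the iterations `1, …, t`. -/
def StillRunning (ε p σ : ℝ) (S : Matrix (Fin n) (Fin n) ℝ) (u : ℕ → EuclideanSpace ℝ (Fin n))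
    (t : ℕ) : Prop :=
  ∀ s, 1 ≤ s → s ≤ t → ¬ specNorm (cov ε p σ S u s) ≤ threshold n ε p

/-- `u` is an admissible sequence of choices: in every iteration that is executed, `u t` is a unit
eigenvector of the current covariance for its largest eigenvalue. -/
def IsChoice (ε p σ : ℝ) (S : Matrix (Fin n) (Fin n) ℝ) (u : ℕ → EuclideanSpace ℝ (Fin n)) :
    Prop :=
  ∀ t, StillRunning ε p σ S u t →
    ‖u t‖ = 1 ∧ Matrix.toEuclideanCLM (𝕜 := ℝ) (cov ε p σ S u t) (u t)
      = specNorm (cov ε p σ S u t) • u t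

/-- The repeat-until loop ends after exactly `m` iterations (at least one). -/
def StopsAfter (ε p σ : ℝ) (S : Matrix (Fin n) (Fin n) ℝ) (u : ℕ → EuclideanSpace ℝ (Fin n))
    (m : ℕ) : Prop :=
  1 ≤ m ∧ StillRunning ε p σ S u (m - 1) ∧ specNorm (cov ε p σ S u m) ≤ threshold n ε p

end

end InfoGreedy

/-! Along a unit eigenvector whose variance λ exceeds the threshold τ = ε²/χ²ₙ(p), the power β =
(1/τ − 1/λ)σ² is exactly what turns λ into λσ²/(βλ + σ²) = τ, and all other eigenvalues stay
(`roots_charpoly_covUpdate`). Each such iteration lowers by one the number of eigenvalues above τ,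
so the loop ends; the power spent plus the power still required is constant, which bounds the total
(`exists_stopsAfter`). Eigenvalues are tracked as the multiset of roots of the characteristic
polynomial, so no eigenbasis has to be followed through the loop.

The measurement vectors do not depend on the outcomes, so the error x − μ_t is an affine function of
the signal and the noise, and its law is N(0, Σ_t) without any conditioning (`hasLaw_sub_mean`). At
the stopping time it is distributed as √Σ z with z standard Gaussian, and ‖√Σ z‖² ≤ τ‖z‖² < ε² as
soon as ‖z‖² < χ²ₙ(p) (`le_multivariateGaussian_norm_lt`). -/

namespace InfoGreedy

/-! ### Rank one updates and positivity of the covariance -/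

open Matrix in
/-- A rank one perturbation along an eigenvector `u` moves the corresponding root of the
characteristic polynomial and no other. -/
theorem charpoly_add_vecMulVec_mul {n : ℕ} (S : Matrix (Fin n) (Fin n) ℝ) (u v : Fin n → ℝ)
    (lam : ℝ) (hn : 1 ≤ n) (hu : S *ᵥ u = lam • u) :
    (S + vecMulVec u v).charpoly * (Polynomial.X - Polynomial.C lam)
      = S.charpoly * (Polynomial.X - Polynomial.C (lam + u ⬝ᵥ v)) := by
  obtain ⟨k, rfl⟩ : ∃ k, n = k + 1 := ⟨n - 1, by omega⟩
  -- Determinants of (t − S)((t − λ) − uvᵀ) = (t − λ)(t − S − uvᵀ), which holds because Su = λu. The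
  -- spare factor (t − λ)ᵏ is cancelled afterwards, as polynomials.
  have key : ∀ t : ℝ, (t - lam) ^ (k + 1) * (S + vecMulVec u v).charpoly.eval t
      = S.charpoly.eval t * ((t - lam) ^ (k + 1) - (u ⬝ᵥ v) * (t - lam) ^ k) := by
    intro t
    have h1 : (scalar (Fin (k + 1)) t - S) * (scalar (Fin (k + 1)) (t - lam) - vecMulVec u v)
        = (t - lam) • (scalar (Fin (k + 1)) t - (S + vecMulVec u v)) := by
      have hSV : S * vecMulVec u v = lam • vecMulVec u v := by
        rw [mul_vecMulVec, hu, smul_vecMulVec]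
      have e (r : ℝ) : scalar (Fin (k + 1)) r = r • (1 : Matrix _ _ ℝ) := by
        rw [scalar_apply, smul_one_eq_diagonal]
      rw [e, e]
      simp only [sub_mul, mul_sub, smul_mul_assoc, mul_smul_comm, one_mul, mul_one, hSV,
        smul_sub, sub_smul, smul_add]
      abel
    have h2 := congrArg Matrix.det h1
    have h3 := Matrix.eval_charpoly (vecMulVec u v) (t - lam)
    rw [charpoly_vecMulVec] at h3
    simp only [Fintype.card_fin, add_tsub_cancel_right, Polynomial.eval_sub, Polynomial.eval_pow,
      Polynomial.eval_X, Polynomial.eval_smul, smul_eq_mul] at h3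
    rw [det_mul, det_smul, Fintype.card_fin, ← h3, ← eval_charpoly, ← eval_charpoly] at h2
    exact h2.symm
  have hX : (Polynomial.X - Polynomial.C lam) ^ k ≠ 0 :=
    pow_ne_zero _ (Polynomial.X_sub_C_ne_zero _)
  apply mul_right_cancel₀ hX
  apply Polynomial.funext
  intro t
  have := key t
  simp only [Polynomial.eval_mul, Polynomial.eval_sub, Polynomial.eval_pow, Polynomial.eval_X,
    Polynomial.eval_C]
  linear_combination this

open Matrix in
/-- Joseph's form of the covariance update, as an identity of quadratic forms. -/
theorem dotProduct_covUpdate_mulVec {n : ℕ} {σ : ℝ} (hσ : 0 < σ) {S : Matrix (Fin n) (Fin n) ℝ}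
    (hS : S.PosSemidef) (a : EuclideanSpace ℝ (Fin n)) (v : Fin n → ℝ) :
    v ⬝ᵥ covUpdate σ S a *ᵥ v
      = (v - (invVariance σ S a * (v ⬝ᵥ S *ᵥ a.ofLp)) • a.ofLp) ⬝ᵥ
          S *ᵥ (v - (invVariance σ S a * (v ⬝ᵥ S *ᵥ a.ofLp)) • a.ofLp)
        + σ ^ 2 * (invVariance σ S a * (v ⬝ᵥ S *ᵥ a.ofLp)) ^ 2 := by
  have hc : invVariance σ S a * (a.ofLp ⬝ᵥ S *ᵥ a.ofLp + σ ^ 2) = 1 := by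
    rw [invVariance, inner_toEuclideanCLM]
    have h0 := hS.dotProduct_mulVec_nonneg a.ofLp
    rw [star_trivial] at h0
    have : 0 < σ ^ 2 := by positivity
    exact inv_mul_cancel₀ (by linarith)
  have hT : Sᵀ = S := hS.isHermitian.eq
  have hsymm (y z : Fin n → ℝ) : y ⬝ᵥ S *ᵥ z = z ⬝ᵥ S *ᵥ y := by
    rw [dotProduct_mulVec, ← mulVec_transpose, hT, dotProduct_comm]
  have hvm : a.ofLp ᵥ* S = S *ᵥ a.ofLp := by rw [← mulVec_transpose, hT]
  set c := invVariance σ S a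
  set g := v ⬝ᵥ S *ᵥ a.ofLp with hg
  have h1 : v ⬝ᵥ covUpdate σ S a *ᵥ v = v ⬝ᵥ S *ᵥ v - c * g ^ 2 := by
    rw [covUpdate, sub_mulVec, smul_mulVec, vecMulVec_mulVec, hvm, dotProduct_sub]
    simp only [dotProduct_smul, smul_eq_mul, MulOpposite.smul_eq_mul_unop, MulOpposite.unop_op]
    rw [dotProduct_comm (S *ᵥ a.ofLp) v, ← hg]
    ring
  rw [h1]
  simp only [mulVec_sub, mulVec_smul, sub_dotProduct, dotProduct_sub, smul_dotProduct,
    dotProduct_smul, smul_eq_mul, hsymm a.ofLp v, ← hg]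
  linear_combination (-c * g ^ 2) * hc

open Matrix in
theorem posSemidef_covUpdate {n : ℕ} {σ : ℝ} (hσ : 0 < σ) {S : Matrix (Fin n) (Fin n) ℝ}
    (hS : S.PosSemidef) (a : EuclideanSpace ℝ (Fin n)) : (covUpdate σ S a).PosSemidef := by
  have hT : Sᵀ = S := hS.isHermitian.eq
  refine .of_dotProduct_mulVec_nonneg ?_ fun v => ?_
  · have hvm : a.ofLp ᵥ* S = S *ᵥ a.ofLp := by rw [← mulVec_transpose, hT]
    change (covUpdate σ S a)ᵀ = _
    rw [covUpdate, transpose_sub, transpose_smul, transpose_vecMulVec, hT, hvm]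
  · rw [star_trivial, dotProduct_covUpdate_mulVec hσ hS]
    have h0 := hS.dotProduct_mulVec_nonneg
      (v - (invVariance σ S a * (v ⬝ᵥ S *ᵥ a.ofLp)) • a.ofLp)
    rw [star_trivial] at h0
    positivity

theorem posSemidef_cov {n : ℕ} {σ : ℝ} (hσ : 0 < σ) (ε p : ℝ) {S : Matrix (Fin n) (Fin n) ℝ}
    (hS : S.PosSemidef) (u : ℕ → EuclideanSpace ℝ (Fin n)) (t : ℕ) :
    (cov ε p σ S u t).PosSemidef := by
  induction t with
  | zero => exact hS
  | succ t ih => exact posSemidef_covUpdate hσ ih _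

/-! ### Power allocation and the effect of one measurement -/

theorem allocatedPower_nonneg (n : ℕ) (ε p σ lam : ℝ) : 0 ≤ allocatedPower n ε p σ lam := by
  unfold allocatedPower
  split_ifs
  · exact le_rfl
  · exact le_max_left _ _

theorem allocatedPower_eq_zero {n : ℕ} {ε p lam : ℝ} (σ : ℝ)
    (h0 : 0 ≤ lam) (h : lam ≤ threshold n ε p) :
    allocatedPower n ε p σ lam = 0 := by
  unfold allocatedPower
  split_ifs with h1
  · rfl
  · have hl : 0 < lam := lt_of_le_of_ne h0 (Ne.symm h1)
    apply max_eq_left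
    refine mul_nonpos_of_nonpos_of_nonneg ?_ (sq_nonneg σ)
    have : (threshold n ε p)⁻¹ ≤ lam⁻¹ := inv_anti₀ hl h
    rw [threshold, inv_div] at this
    rw [one_div]
    linarith

theorem allocatedPower_of_threshold_lt {n : ℕ} {ε p lam : ℝ} (σ : ℝ) (hε : 0 < ε)
    (hq : 0 < chiSquaredQuantile n p) (h : threshold n ε p < lam) :
    allocatedPower n ε p σ lam = ((threshold n ε p)⁻¹ - lam⁻¹) * σ ^ 2 := by
  have ht : 0 < threshold n ε p := by unfold threshold; positivity
  have hl : 0 < lam := ht.trans h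
  rw [allocatedPower, if_neg hl.ne', threshold, inv_div, one_div]
  apply max_eq_right
  have : lam⁻¹ ≤ (threshold n ε p)⁻¹ := inv_anti₀ ht h.le
  rw [threshold, inv_div] at this
  exact mul_nonneg (by linarith) (sq_nonneg σ)

theorem covUpdate_zero {n : ℕ} (σ : ℝ) (S : Matrix (Fin n) (Fin n) ℝ) :
    covUpdate σ S 0 = S := by
  simp [covUpdate]

open Matrix in
/-- Measuring along a unit eigenvector `u` with variance `lam` above the threshold lowers that
variance to the threshold. -/
theorem covUpdate_measurementVector {n : ℕ} {σ ε p : ℝ} (hσ : 0 < σ) (hε : 0 < ε)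
    (hq : 0 < chiSquaredQuantile n p) {S : Matrix (Fin n) (Fin n) ℝ} (hS : S.PosSemidef)
    {u : EuclideanSpace ℝ (Fin n)} (hu1 : ‖u‖ = 1)
    (hu : Matrix.toEuclideanCLM (𝕜 := ℝ) S u = specNorm S • u)
    (h : threshold n ε p < specNorm S) :
    covUpdate σ S (measurementVector ε p σ S u)
      = S + vecMulVec u.ofLp ((threshold n ε p - specNorm S) • u.ofLp) := by
  have ht : 0 < threshold n ε p := by unfold threshold; positivity
  have hT : Sᵀ = S := hS.isHermitian.eq
  have hβ := allocatedPower_of_threshold_lt σ hε hq h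
  have hβ0 := allocatedPower_nonneg n ε p σ (specNorm S)
  set lam := specNorm S with hlam
  set τ := threshold n ε p
  have hl : 0 < lam := ht.trans h
  set β := allocatedPower n ε p σ lam
  have hSu : S *ᵥ u.ofLp = lam • u.ofLp := congrArg WithLp.ofLp hu
  have hvm : u.ofLp ᵥ* S = S *ᵥ u.ofLp := by rw [← mulVec_transpose, hT]
  have hinv : invVariance σ S (measurementVector ε p σ S u) = (β * lam + σ ^ 2)⁻¹ := by
    rw [invVariance, measurementVector, map_smul, hu, inner_smul_left, inner_smul_right,
      inner_smul_right, real_inner_self_eq_norm_sq, hu1]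
    have := Real.mul_self_sqrt hβ0
    simp only [RCLike.conj_to_real]
    congr 2
    linear_combination lam * this
  -- The choice of β enters here: it makes βλ + σ² equal to σ²λ/τ.
  have hval : (β * lam + σ ^ 2)⁻¹ * (β * lam ^ 2) = lam - τ := by
    have hden : β * lam + σ ^ 2 = σ ^ 2 * lam / τ := by
      rw [hβ]
      field_simp [hl.ne', ht.ne', hσ.ne']
      ring
    have hnum : β * lam ^ 2 = σ ^ 2 * lam / τ * (lam - τ) := by
      rw [hβ]
      field_simp [hl.ne', ht.ne', hσ.ne']
    have hpos : 0 < σ ^ 2 * lam / τ := by positivity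
    rw [hden, hnum, inv_mul_cancel_left₀ hpos.ne']
  have hoL : (measurementVector ε p σ S u).ofLp = Real.sqrt β • u.ofLp := rfl
  rw [covUpdate, hinv, hoL, mulVec_smul, smul_vecMul, hvm, hSu, sub_eq_add_neg]
  congr 1
  simp only [smul_vecMulVec, vecMulVec_smul, smul_smul, ← neg_smul]
  congr 1
  have := Real.mul_self_sqrt hβ0
  linear_combination (-(β * lam + σ ^ 2)⁻¹ * lam ^ 2) * this - hval

theorem specNorm_nonneg {n : ℕ} (S : Matrix (Fin n) (Fin n) ℝ) : 0 ≤ specNorm S := norm_nonneg _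

-- The rank one term is u((τ − λ)u)ᵀ with ‖u‖ = 1, so the moved root λ lands on λ + (τ − λ) = τ. The
-- additive form avoids subtraction of multisets.
open Polynomial in
theorem roots_charpoly_covUpdate {n : ℕ} (hn : 1 ≤ n) {σ ε p : ℝ} (hσ : 0 < σ) (hε : 0 < ε)
    (hq : 0 < chiSquaredQuantile n p) {S : Matrix (Fin n) (Fin n) ℝ} (hS : S.PosSemidef)
    {u : EuclideanSpace ℝ (Fin n)} (hu1 : ‖u‖ = 1)
    (hu : Matrix.toEuclideanCLM (𝕜 := ℝ) S u = specNorm S • u)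
    (h : threshold n ε p < specNorm S) :
    (covUpdate σ S (measurementVector ε p σ S u)).charpoly.roots + {specNorm S}
      = S.charpoly.roots + {threshold n ε p} := by
  have h1 := charpoly_add_vecMulVec_mul S u.ofLp ((threshold n ε p - specNorm S) • u.ofLp)
    (specNorm S) hn (congrArg WithLp.ofLp hu)
  have huu : u.ofLp ⬝ᵥ u.ofLp = 1 := by
    have := EuclideanSpace.inner_eq_star_dotProduct u u
    rw [real_inner_self_eq_norm_sq, hu1, star_trivial] at this
    linarith
  rw [← covUpdate_measurementVector hσ hε hq hS hu1 hu h, dotProduct_smul, huu, smul_eq_mul,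
    mul_one, add_sub_cancel] at h1
  have h2 := congrArg Polynomial.roots h1
  rwa [roots_mul (mul_ne_zero (Matrix.charpoly_monic _).ne_zero (X_sub_C_ne_zero _)),
    roots_mul (mul_ne_zero (Matrix.charpoly_monic _).ne_zero (X_sub_C_ne_zero _)),
    roots_X_sub_C, roots_X_sub_C] at h2

/-! ### Termination and the power budget -/

/-- The power needed to bring all the eigenvalues of `S` down to the threshold. -/
noncomputable def requiredPower {n : ℕ} (ε p σ : ℝ) (S : Matrix (Fin n) (Fin n) ℝ) : ℝ :=
  (S.charpoly.roots.map (allocatedPower n ε p σ)).sum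

theorem requiredPower_nonneg {n : ℕ} (ε p σ : ℝ) (S : Matrix (Fin n) (Fin n) ℝ) :
    0 ≤ requiredPower ε p σ S := by
  refine Multiset.sum_nonneg fun y hy => ?_
  obtain ⟨l, -, rfl⟩ := Multiset.mem_map.1 hy
  exact allocatedPower_nonneg _ _ _ _ _

theorem requiredPower_eq_sum {n : ℕ} (ε p σ : ℝ) {S : Matrix (Fin n) (Fin n) ℝ}
    (hS : S.IsHermitian) :
    requiredPower ε p σ S = ∑ i ∈ Finset.univ.filter (fun i => hS.eigenvalues i ≠ 0),
      max 0 ((chiSquaredQuantile n p / ε ^ 2 - 1 / hS.eigenvalues i) * σ ^ 2) := by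
  rw [requiredPower, hS.roots_charpoly_eq_eigenvalues, Multiset.map_map, Finset.sum_filter]
  refine Finset.sum_congr rfl fun i _ => ?_
  simp [allocatedPower]

/-- Conservation law: the replaced root λ carried exactly the power now spent, and its replacement τ
needs none. The case below the threshold, where nothing is measured, is included because the first
iteration runs without a prior test. -/
theorem requiredPower_covUpdate {n : ℕ} (hn : 1 ≤ n) {σ ε p : ℝ} (hσ : 0 < σ) (hε : 0 < ε)
    (hq : 0 < chiSquaredQuantile n p) {S : Matrix (Fin n) (Fin n) ℝ} (hS : S.PosSemidef)
    {u : EuclideanSpace ℝ (Fin n)} (hu1 : ‖u‖ = 1)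
    (hu : Matrix.toEuclideanCLM (𝕜 := ℝ) S u = specNorm S • u) :
    requiredPower ε p σ (covUpdate σ S (measurementVector ε p σ S u))
      + ‖measurementVector ε p σ S u‖ ^ 2 = requiredPower ε p σ S := by
  have hnorm : ‖measurementVector ε p σ S u‖ ^ 2 = allocatedPower n ε p σ (specNorm S) := by
    rw [measurementVector, norm_smul, hu1, mul_one, Real.norm_eq_abs, sq_abs,
      Real.sq_sqrt (allocatedPower_nonneg _ _ _ _ _)]
  rcases lt_or_ge (threshold n ε p) (specNorm S) with h | h
  · have h1 := congrArg (fun m => (Multiset.map (allocatedPower n ε p σ) m).sum)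
      (roots_charpoly_covUpdate hn hσ hε hq hS hu1 hu h)
    have ht : 0 < threshold n ε p := by unfold threshold; positivity
    simp only [Multiset.map_add, Multiset.sum_add, Multiset.map_singleton, Multiset.sum_singleton,
      allocatedPower_eq_zero σ ht.le le_rfl, add_zero] at h1
    rw [hnorm]
    exact h1
  · have h0 := allocatedPower_eq_zero σ (specNorm_nonneg S) h
    have ha : measurementVector ε p σ S u = 0 := by simp [measurementVector, h0]
    rw [ha, covUpdate_zero]
    simp

theorem card_roots_covUpdate {n : ℕ} (hn : 1 ≤ n) {σ ε p : ℝ} (hσ : 0 < σ) (hε : 0 < ε)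
    (hq : 0 < chiSquaredQuantile n p) {S : Matrix (Fin n) (Fin n) ℝ} (hS : S.PosSemidef)
    {u : EuclideanSpace ℝ (Fin n)} (hu1 : ‖u‖ = 1)
    (hu : Matrix.toEuclideanCLM (𝕜 := ℝ) S u = specNorm S • u)
    (h : threshold n ε p < specNorm S) :
    ((covUpdate σ S (measurementVector ε p σ S u)).charpoly.roots.countP (threshold n ε p < ·)) + 1
      = S.charpoly.roots.countP (threshold n ε p < ·) := by
  have h1 := congrArg (Multiset.countP (threshold n ε p < ·))
      (roots_charpoly_covUpdate hn hσ hε hq hS hu1 hu h)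
  simpa [Multiset.countP_add, ← Multiset.cons_zero, Multiset.countP_cons_of_pos, h] using h1

/-- The loop ends, and the power it uses is at most the power required. -/
theorem exists_stopsAfter {n : ℕ} (hn : 1 ≤ n) {σ ε p : ℝ} (hσ : 0 < σ) (hε : 0 < ε)
    (hq : 0 < chiSquaredQuantile n p) {S : Matrix (Fin n) (Fin n) ℝ} (hS : S.PosSemidef)
    {u : ℕ → EuclideanSpace ℝ (Fin n)} (hu : IsChoice ε p σ S u) :
    ∃ m, StopsAfter ε p σ S u m ∧
      ∑ t ∈ Finset.range m, ‖sensing ε p σ S u t‖ ^ 2 ≤ requiredPower ε p σ S := by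
  classical
  have hfin : ∃ m, 1 ≤ m ∧ specNorm (cov ε p σ S u m) ≤ threshold n ε p := by
    by_contra! hcon
    have hrun (t : ℕ) : StillRunning ε p σ S u t := fun s hs _ => not_le.2 (hcon s hs)
    -- The count starts at covariance 1: the initial covariance is never tested and may already be
    -- below the threshold.
    have hcount (t : ℕ) : (cov ε p σ S u (t + 1)).charpoly.roots.countP (threshold n ε p < ·) + t
        = (cov ε p σ S u 1).charpoly.roots.countP (threshold n ε p < ·) := by
      induction t with
      | zero => rfl
      | succ t ih =>
        have := card_roots_covUpdate hn hσ hε hq (posSemidef_cov hσ ε p hS u (t + 1))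
          (hu _ (hrun (t + 1))).1 (hu _ (hrun (t + 1))).2 (hcon (t + 1) (by omega))
        rw [← ih, ← this, cov]
        ring
    have := hcount ((cov ε p σ S u 1).charpoly.roots.countP (threshold n ε p < ·) + 1)
    omega
  have hrun (t : ℕ) (ht : t < Nat.find hfin) : StillRunning ε p σ S u t :=
    fun s hs hst h => Nat.find_min hfin (lt_of_le_of_lt hst ht) ⟨hs, h⟩
  have hspec := Nat.find_spec hfin
  refine ⟨Nat.find hfin, ⟨hspec.1, hrun _ (by omega), hspec.2⟩, ?_⟩
  have hsum (t : ℕ) (ht : t ≤ Nat.find hfin) : requiredPower ε p σ (cov ε p σ S u t)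
      + ∑ s ∈ Finset.range t, ‖sensing ε p σ S u s‖ ^ 2 = requiredPower ε p σ S := by
    induction t with
    | zero => simp [cov]
    | succ t ih =>
      have := requiredPower_covUpdate hn hσ hε hq (posSemidef_cov hσ ε p hS u t)
        (hu t (hrun t ht)).1 (hu t (hrun t ht)).2
      rw [Finset.sum_range_succ, ← ih (by omega), ← this, cov, sensing]
      ring
  have := hsum _ le_rfl
  linarith [requiredPower_nonneg ε p σ (cov ε p σ S u (Nat.find hfin))]

/-! ### Chi-squared quantiles and Gaussian confidence balls -/

/-- Fubini: once the other coordinates are fixed, the first takes at most two values, and a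
nondegenerate Gaussian has no atoms. -/
theorem pi_gaussianReal_sum_sq_eq (n : ℕ) (hn : 1 ≤ n) (q : ℝ) :
    Measure.pi (fun _ : Fin n => gaussianReal 0 1) {z | ∑ i, z i ^ 2 = q} = 0 := by
  obtain ⟨k, rfl⟩ : ∃ k, n = k + 1 := ⟨n - 1, by omega⟩
  have := nullSingletonClass_gaussianReal (μ := 0) (v := 1) one_ne_zero
  have hmp := measurePreserving_piFinSuccAbove (fun _ : Fin (k + 1) => gaussianReal 0 1) 0
  have hT : MeasurableSet {y : ℝ × (Fin k → ℝ) | y.1 ^ 2 + ∑ i, y.2 i ^ 2 = q} :=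
    measurableSet_eq_fun (by fun_prop) (by fun_prop)
  have hpre : {z : Fin (k + 1) → ℝ | ∑ i, z i ^ 2 = q}
      = MeasurableEquiv.piFinSuccAbove (fun _ => ℝ) 0 ⁻¹'
          {y : ℝ × (Fin k → ℝ) | y.1 ^ 2 + ∑ i, y.2 i ^ 2 = q} := by
    ext z
    simp [Fin.sum_univ_succ, MeasurableEquiv.piFinSuccAbove, Fin.insertNthEquiv, Fin.tail]
  rw [hpre, hmp.measure_preimage hT.nullMeasurableSet, Measure.prod_apply_symm hT]
  refine (lintegral_congr fun y => ?_).trans lintegral_zero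
  refine measure_mono_null (t := {√(q - ∑ i, y i ^ 2), -√(q - ∑ i, y i ^ 2)}) ?_
    (Set.Finite.measure_zero (by simp) _)
  intro r hr
  simp only [Set.mem_preimage, Set.mem_ofPred_eq] at hr
  have h1 : r ^ 2 = q - ∑ i, y i ^ 2 := by linarith
  have h2 : r ^ 2 = (√(q - ∑ i, y i ^ 2)) ^ 2 := by
    rw [Real.sq_sqrt (by rw [← h1]; positivity), h1]
  exact sq_eq_sq_iff_eq_or_eq_neg.1 h2

theorem measurable_sum_sq (n : ℕ) : Measurable (fun z : Fin n → ℝ => ∑ i, z i ^ 2) := by fun_prop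

instance isProbabilityMeasure_chiSquared (n : ℕ) : IsProbabilityMeasure (chiSquared n) :=
  Measure.isProbabilityMeasure_map (measurable_sum_sq n).aemeasurable

theorem chiSquared_singleton {n : ℕ} (hn : 1 ≤ n) (q : ℝ) : chiSquared n {q} = 0 := by
  rw [chiSquared, Measure.map_apply (measurable_sum_sq n) (measurableSet_singleton q)]
  exact pi_gaussianReal_sum_sq_eq n hn q

theorem cdf_chiSquared_of_nonpos {n : ℕ} (hn : 1 ≤ n) {t : ℝ} (ht : t ≤ 0) :
    cdf (chiSquared n) t = 0 := by
  rw [cdf_eq_real, measureReal_def, chiSquared,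
    Measure.map_apply (measurable_sum_sq n) measurableSet_Iic]
  rw [measure_mono_null _ (pi_gaussianReal_sum_sq_eq n hn 0), ENNReal.toReal_zero]
  intro z hz
  have h0 : 0 ≤ ∑ i, z i ^ 2 := Finset.sum_nonneg fun i _ => sq_nonneg _
  exact le_antisymm (le_trans hz ht) h0

/-- Right continuity of the distribution function passes the bound to the infimum; p < 1 makes the
set nonempty. -/
theorem le_cdf_chiSquaredQuantile (n : ℕ) {p : ℝ} (hp1 : p < 1) :
    p ≤ cdf (chiSquared n) (chiSquaredQuantile n p) := by
  have hne : {t : ℝ | p ≤ cdf (chiSquared n) t}.Nonempty := by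
    have := (tendsto_cdf_atTop (chiSquared n)).eventually (eventually_ge_nhds hp1)
    exact this.exists
  have hright := ((cdf (chiSquared n)).right_continuous (chiSquaredQuantile n p)).mono_left
    (nhdsWithin_mono _ Set.Ioi_subset_Ici_self)
  refine ge_of_tendsto hright ?_
  filter_upwards [self_mem_nhdsWithin] with t ht
  obtain ⟨s, hs, hst⟩ := exists_lt_of_csInf_lt hne ht
  exact le_trans hs ((cdf (chiSquared n)).mono hst.le)

theorem chiSquaredQuantile_pos {n : ℕ} (hn : 1 ≤ n) {p : ℝ} (hp0 : 0 < p) (hp1 : p < 1) :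
    0 < chiSquaredQuantile n p := by
  by_contra! h
  have := le_cdf_chiSquaredQuantile n hp1
  rw [cdf_chiSquared_of_nonpos hn h] at this
  linarith

/-- The strict inequality, needed for an error strictly below ε, costs nothing since the chi-squared
law has no atoms. -/
theorem le_stdGaussian_norm_sq_lt {n : ℕ} (hn : 1 ≤ n) {p : ℝ} (hp1 : p < 1) :
    p ≤ (stdGaussian (EuclideanSpace ℝ (Fin n))).real {z | ‖z‖ ^ 2 < chiSquaredQuantile n p} := by
  have h1 := le_cdf_chiSquaredQuantile n hp1
  have hmeas : MeasurableSet {z : EuclideanSpace ℝ (Fin n) | ‖z‖ ^ 2 < chiSquaredQuantile n p} :=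
    measurableSet_lt (by fun_prop) (by fun_prop)
  have : NullSingletonClass (chiSquared n) := ⟨chiSquared_singleton hn⟩
  rw [cdf_eq_real, measureReal_def, ← measure_congr Iio_ae_eq_Iic, chiSquared,
    Measure.map_apply (measurable_sum_sq n) measurableSet_Iio] at h1
  rw [← map_pi_eq_stdGaussian, measureReal_def, Measure.map_apply (by fun_prop) hmeas]
  convert h1 using 4
  ext z
  simp [EuclideanSpace.real_norm_sq_eq]

open Matrix in
open scoped MatrixOrder in
/-- A centred Gaussian vector whose covariance is below the threshold is small with probability at
least `p`. -/
theorem le_multivariateGaussian_norm_lt {n : ℕ} (hn : 1 ≤ n) {ε p : ℝ} (hε : 0 < ε)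
    (hp0 : 0 < p) (hp1 : p < 1) {S : Matrix (Fin n) (Fin n) ℝ} (hS : S.PosSemidef)
    (h : specNorm S ≤ threshold n ε p) :
    p ≤ (multivariateGaussian 0 S).real {z | ‖z‖ < ε} := by
  have hq := chiSquaredQuantile_pos hn hp0 hp1
  refine (le_stdGaussian_norm_sq_lt hn hp1).trans ?_
  rw [multivariateGaussian, map_measureReal_apply (by fun_prop)
    (measurableSet_lt (by fun_prop) (by fun_prop))]
  refine measureReal_mono fun z hz => ?_
  simp only [Set.mem_ofPred_eq, Set.mem_preimage, zero_add] at hz ⊢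
  have hsq : ‖toEuclideanCLM (𝕜 := ℝ) (CFC.sqrt S) z‖ ^ 2
      = inner ℝ z (toEuclideanCLM (𝕜 := ℝ) S z) := by
    have hsa : IsSelfAdjoint (toEuclideanCLM (n := Fin n) (𝕜 := ℝ) (CFC.sqrt S)) :=
      (CFC.sqrt_nonneg S).isSelfAdjoint.map _
    rw [← real_inner_self_eq_norm_sq, ← ContinuousLinearMap.adjoint_inner_right, hsa.adjoint_eq,
      ← ContinuousLinearMap.comp_apply, ← ContinuousLinearMap.mul_def, ← map_mul,
      CFC.sqrt_mul_sqrt_self _ hS.nonneg]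
  have hle : inner ℝ z (toEuclideanCLM (𝕜 := ℝ) S z) ≤ specNorm S * ‖z‖ ^ 2 := by
    refine (real_inner_le_norm _ _).trans ?_
    have := (toEuclideanCLM (𝕜 := ℝ) S).le_opNorm z
    calc ‖z‖ * ‖toEuclideanCLM (𝕜 := ℝ) S z‖ ≤ ‖z‖ * (specNorm S * ‖z‖) := by gcongr; exact this
      _ = specNorm S * ‖z‖ ^ 2 := by ring
  have ht : 0 < threshold n ε p := by unfold threshold; positivity
  refine lt_of_pow_lt_pow_left₀ 2 hε.le ?_
  calc ‖toEuclideanCLM (𝕜 := ℝ) (CFC.sqrt S) z‖ ^ 2 ≤ specNorm S * ‖z‖ ^ 2 := hsq.trans_le hle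
    _ ≤ threshold n ε p * ‖z‖ ^ 2 := by gcongr
    _ < threshold n ε p * chiSquaredQuantile n p := by gcongr
    _ = ε ^ 2 := by unfold threshold; field_simp

/-! ### The law of the estimation error -/

/-- Both groupings say that the joint law is a triple product, up to reassociation. Applied to the
signal, the past noise and the new noise. -/
theorem indepFun_prodMk_left {Ω α β γ : Type*} {mΩ : MeasurableSpace Ω} [MeasurableSpace α]
    [MeasurableSpace β] [MeasurableSpace γ] {P : Measure Ω} [IsProbabilityMeasure P]
    {X : Ω → α} {A : Ω → β} {B : Ω → γ} (hX : AEMeasurable X P) (hA : AEMeasurable A P)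
    (hB : AEMeasurable B P) (h : IndepFun X (fun ω => (A ω, B ω)) P) (hAB : IndepFun A B P) :
    IndepFun (fun ω => (X ω, A ω)) B P := by
  have hXA : IndepFun X A P := h.comp measurable_id measurable_fst
  have := Measure.isProbabilityMeasure_map hX
  have := Measure.isProbabilityMeasure_map hA
  have := Measure.isProbabilityMeasure_map hB
  rw [indepFun_iff_map_prod_eq_prod_map_map hX (hA.prodMk hB),
    (indepFun_iff_map_prod_eq_prod_map_map hA hB).1 hAB] at h
  rw [indepFun_iff_map_prod_eq_prod_map_map (hX.prodMk hA) hB,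
    (indepFun_iff_map_prod_eq_prod_map_map hX hA).1 hXA]
  apply MeasurableEquiv.prodAssoc.map_measurableEquiv_injective
  rw [Measure.prodAssoc_prod, ← h, AEMeasurable.map_map_of_aemeasurable
    (MeasurableEquiv.measurable _).aemeasurable ((hX.prodMk hA).prodMk hB)]
  rfl

variable {n : ℕ}

/-- The mean after `t` iterations is a measurable function of the signal and of the noise in these
iterations. -/
theorem exists_measurable_mean_eq (ε p σ : ℝ) (μ : EuclideanSpace ℝ (Fin n))
    (S : Matrix (Fin n) (Fin n) ℝ) (u : ℕ → EuclideanSpace ℝ (Fin n)) (t : ℕ) :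
    ∃ G : EuclideanSpace ℝ (Fin n) × (Finset.range t → ℝ) → EuclideanSpace ℝ (Fin n),
      Measurable G ∧ ∀ x w, mean ε p σ μ S u x w t = G (x, fun i => w i) := by
  induction t with
  | zero => exact ⟨fun _ => μ, measurable_const, fun _ _ => rfl⟩
  | succ t ih =>
    obtain ⟨G, hG, h⟩ := ih
    refine ⟨fun y => meanUpdate σ (cov ε p σ S u t) (sensing ε p σ S u t)
      (G (y.1, fun i => y.2 ⟨i, Finset.range_subset_range.2 t.le_succ i.2⟩))
      (inner ℝ (sensing ε p σ S u t) y.1 + y.2 ⟨t, Finset.self_mem_range_succ t⟩), ?_, ?_⟩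
    · unfold meanUpdate
      have : Measurable fun y : EuclideanSpace ℝ (Fin n) × (Finset.range (t + 1) → ℝ) =>
          G (y.1, fun i : Finset.range t =>
            y.2 ⟨i, Finset.range_subset_range.2 t.le_succ i.2⟩) :=
        hG.comp (by fun_prop)
      fun_prop
    · intro x w
      rw [mean, h]

open Matrix in
/-- The Kalman update of a centred Gaussian error. -/
theorem hasLaw_error_update {σ : ℝ} (hσ : 0 < σ) {v : NNReal} (hv : (v : ℝ) = σ ^ 2)
    {S : Matrix (Fin n) (Fin n) ℝ}
    (hS : S.PosSemidef) (a : EuclideanSpace ℝ (Fin n)) {Ω : Type*} [MeasurableSpace Ω]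
    {P : Measure Ω} [IsProbabilityMeasure P] {e : Ω → EuclideanSpace ℝ (Fin n)} {w : Ω → ℝ}
    (he : HasLaw e (multivariateGaussian 0 S) P)
    (hw : HasLaw w (gaussianReal 0 v) P) (hew : IndepFun e w P) :
    HasLaw (fun ω => e ω - (invVariance σ S a * (inner ℝ a (e ω) + w ω)) •
      toEuclideanCLM (𝕜 := ℝ) S a) (multivariateGaussian 0 (covUpdate σ S a)) P := by
  set c := invVariance σ S a with hc
  set g := toEuclideanCLM (𝕜 := ℝ) S a with hg
  have hem := he.aemeasurable
  have hwm := hw.aemeasurable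
  refine ⟨by fun_prop, ?_⟩
  have hsplit : (fun ω => e ω - (c * (inner ℝ a (e ω) + w ω)) • g)
      = fun ω => (e ω - (c * inner ℝ a (e ω)) • g) + (-(c * w ω)) • g := by
    ext1 ω
    module
  have hm1 : Measurable fun z : EuclideanSpace ℝ (Fin n) => z - (c * inner ℝ a z) • g := by fun_prop
  have hm2 : Measurable fun r : ℝ => (-(c * r)) • g := by fun_prop
  have hind : IndepFun (fun ω => e ω - (c * inner ℝ a (e ω)) • g) (fun ω => (-(c * w ω)) • g) P :=
    hew.comp hm1 hm2
  have : IsProbabilityMeasure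
      (P.map fun ω => (e ω - (c * inner ℝ a (e ω)) • g) + (-(c * w ω)) • g) :=
    Measure.isProbabilityMeasure_map (by fun_prop)
  rw [hsplit]
  apply Measure.ext_of_charFun
  rw [hind.charFun_map_fun_add_eq_mul (by fun_prop) (by fun_prop)]
  ext y
  -- The adjoint of e ↦ e − c⟨a, e⟩g sends y to y − c⟨y, g⟩a, the very vector in Joseph's form; the
  -- noise supplies its remaining square term.
  have h1 : charFun (P.map fun ω => e ω - (c * inner ℝ a (e ω)) • g) y
      = charFun (multivariateGaussian 0 S) (y - (c * inner ℝ y g) • a) := by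
    rw [← he.map_eq, charFun_apply, charFun_apply, integral_map (by fun_prop) (by fun_prop),
      integral_map (by fun_prop) (by fun_prop)]
    congr with ω
    simp only [inner_sub_left, inner_sub_right, inner_smul_left, inner_smul_right,
      RCLike.conj_to_real, real_inner_comm a (e ω), real_inner_comm g y]
    congr 3
    ring
  have h2 : charFun (P.map fun ω => (-(c * w ω)) • g) y
      = charFun (gaussianReal 0 v) (-(c * inner ℝ y g)) := by
    rw [← hw.map_eq, charFun_apply, charFun_apply_real, integral_map (by fun_prop) (by fun_prop),
      integral_map (by fun_prop) (by fun_prop)]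
    congr with ω
    simp only [inner_smul_left, RCLike.conj_to_real, real_inner_comm g y]
    push_cast
    congr 2
    ring
  rw [Pi.mul_apply, h1, h2, charFun_multivariateGaussian hS, charFun_gaussianReal,
    charFun_multivariateGaussian (posSemidef_covUpdate hσ hS a), ← Complex.exp_add,
    dotProduct_covUpdate_mulVec hσ hS a, hg, inner_toEuclideanCLM]
  congr 1
  simp only [inner_zero_right, Complex.ofReal_zero, WithLp.ofLp_sub, WithLp.ofLp_smul, hv]
  push_cast
  ring

/-- The error after `t` iterations is a centred Gaussian vector with the covariance that the
algorithm holds. -/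
theorem hasLaw_sub_mean {σ : ℝ} (hσ : 0 < σ) {v : NNReal} (hv : (v : ℝ) = σ ^ 2) (ε p : ℝ)
    (μ : EuclideanSpace ℝ (Fin n)) {S : Matrix (Fin n) (Fin n) ℝ} (hS : S.PosSemidef) {Ω : Type*} [MeasurableSpace Ω]
    {P : Measure Ω} [IsProbabilityMeasure P]
    {x : Ω → EuclideanSpace ℝ (Fin n)} (hx : HasLaw x (multivariateGaussian μ S) P)
    {w : ℕ → Ω → ℝ} (hw : ∀ t, HasLaw (w t) (gaussianReal 0 v) P)
    (hw_indep : iIndepFun w P) (hxw : IndepFun x (fun ω t => w t ω) P)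
    (u : ℕ → EuclideanSpace ℝ (Fin n)) (t : ℕ) :
    HasLaw (fun ω => x ω - mean ε p σ μ S u (x ω) (fun t => w t ω) t)
      (multivariateGaussian 0 (cov ε p σ S u t)) P := by
  have hwm (t : ℕ) := (hw t).aemeasurable
  induction t with
  | zero =>
    refine ⟨hx.aemeasurable.sub_const μ, ?_⟩
    change P.map ((fun z => z - μ) ∘ x) = _
    rw [← AEMeasurable.map_map_of_aemeasurable (by fun_prop) hx.aemeasurable, hx.map_eq,
      multivariateGaussian, multivariateGaussian, Measure.map_map (by fun_prop) (by fun_prop)]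
    congr 1
    ext1 z
    simp [cov]
  | succ t ih =>
    obtain ⟨G, hG, hmean⟩ := exists_measurable_mean_eq ε p σ μ S u t
    have hind : IndepFun (fun ω (i : Finset.range t) => w i ω) (w t) P :=
      (hw_indep.indepFun_finset₀ (Finset.range t) {t} (by simp) hwm).comp measurable_id
        (measurable_pi_apply (⟨t, Finset.mem_singleton_self t⟩ : ({t} : Finset ℕ)))
    have hx3 : IndepFun x (fun ω => (fun i : Finset.range t => w i ω, w t ω)) P :=
      hxw.comp (ψ := fun v : ℕ → ℝ => ((fun i : Finset.range t => v i), v t)) measurable_id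
        (by fun_prop)
    have hxa := indepFun_prodMk_left hx.aemeasurable (by fun_prop) (hwm t) hx3 hind
    -- The current error involves only the signal and the noise before iteration t.
    have hew : IndepFun (fun ω => x ω - mean ε p σ μ S u (x ω) (fun t => w t ω) t) (w t) P := by
      simp only [hmean]
      exact hxa.comp (φ := fun y => y.1 - G y) (by fun_prop) measurable_id
    have := hasLaw_error_update hσ hv (posSemidef_cov hσ ε p hS u t) (sensing ε p σ S u t) ih
      (hw t) hew
    -- The innovation y − aᵀμ_t equals aᵀ(x − μ_t) + w_t, so the new error is the Kalman update of
    -- the old one.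
    refine (hasLaw_congr (Filter.Eventually.of_forall fun ω => ?_)).1 this
    simp only [mean, meanUpdate, inner_sub_right]
    module

end InfoGreedy

theorem mainTheorem6 {n : ℕ} (hn : 1 ≤ n)
    (μ : EuclideanSpace ℝ (Fin n)) (S : Matrix (Fin n) (Fin n) ℝ) (hS : S.PosSemidef)
    (σ ε p : ℝ) (hσ : 0 < σ) (hε : 0 < ε) (hp0 : 0 < p) (hp1 : p < 1)
    {Ω : Type*} [MeasurableSpace Ω] (P : Measure Ω) [IsProbabilityMeasure P]
    (x : Ω → EuclideanSpace ℝ (Fin n)) (hx : HasLaw x (multivariateGaussian μ S) P)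
    (w : ℕ → Ω → ℝ) (hw : ∀ t, HasLaw (w t) (gaussianReal 0 ⟨σ ^ 2, sq_nonneg σ⟩) P)
    (hw_indep : iIndepFun w P) (hxw : IndepFun x (fun ω t => w t ω) P)
    (u : ℕ → EuclideanSpace ℝ (Fin n)) (hu : InfoGreedy.IsChoice ε p σ S u) :
    ∃ m : ℕ, InfoGreedy.StopsAfter ε p σ S u m ∧
      ∑ t ∈ Finset.range m, ‖InfoGreedy.sensing ε p σ S u t‖ ^ 2 ≤
        ∑ i ∈ Finset.univ.filter (fun i => hS.isHermitian.eigenvalues i ≠ 0),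
          max 0 ((InfoGreedy.chiSquaredQuantile n p / ε ^ 2
            - 1 / hS.isHermitian.eigenvalues i) * σ ^ 2) ∧
      p ≤ P.real {ω | ‖x ω - InfoGreedy.mean ε p σ μ S u (x ω) (fun t => w t ω) m‖ < ε} := by
  obtain ⟨m, hm, hpow⟩ := InfoGreedy.exists_stopsAfter hn hσ hε
    (InfoGreedy.chiSquaredQuantile_pos hn hp0 hp1) hS hu
  refine ⟨m, hm, hpow.trans_eq (InfoGreedy.requiredPower_eq_sum ε p σ hS.isHermitian), ?_⟩
  rw [(InfoGreedy.hasLaw_sub_mean hσ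
    (v := ⟨σ ^ 2, sq_nonneg σ⟩) rfl ε p μ hS hx hw hw_indep hxw u m).measureReal_eq
    (p := fun z => ‖z‖ < ε) (measurableSet_lt (by fun_prop) (by fun_prop))]
  exact InfoGreedy.le_multivariateGaussian_norm_lt hn hε hp0 hp1
    (InfoGreedy.posSemidef_cov hσ ε p hS u m) hm.2.2
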